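/- Let $r\ge 2$ and let $\mathcal A=\{0,\dots,r-1\}$ be an alphabet with $r$ letters. A $\mathbb Z$-shift over a finite alphabet $\mathcal A$ is a closed subset of $\mathcal A^{\mathbb Z}$ invariant under the shift map $\sigma(x)_k=x_{k+1}$ and its inverse, with $\sigma$ acting on it. For $n\ge 1$, a $\mathbb Z$-shift $X$ with a metric $d$ inducing its (product) topology is *positively $n$-expansive* if there is $\varepsilon>0$ such that for every $x\in X$ the set $\{y\in X : d(\sigma^t(x),\sigma^t(y))<\varepsilon \text{ for all } t\in\mathbb N\}$ has at most $n$ elements. For $i\in\mathcal A$ let $\tau_i$ be the substitution given by $\tau_i(i)=i$ and $\tau_i(j)=ij$ for $j\ne i$. For a sequence $(i_t)_{t\in\mathbb N}$ in $\mathcal A$, the associated *S-adic limit set* $\Omega$ is the set of all $x\in\mathcal A^{\mathbb Z}$ such that for every $t\in\mathbb N$ there are an increasing sequence of integers $(k_s)_{s\in\mathbb Z}$ and $y\in\mathcal A^{\mathbb Z}$ with $x_{[k_s,k_{s+1})}=\tau_{i_0}\tau_{i_1}\cdots\tau_{i_{t-1}}(y_s)$ for all $s\in\mathbb Z$; the associated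 *S-adic shift* (in the sense of languages) is the set of all $x\in\mathcal A^{\mathbb Z}$ each of whose finite factors occurs in some word $\tau_{i_0}\cdots\tau_{i_{t-1}}(a)$ with $t\in\mathbb N$, $a\in\mathcal A$. Both are $\mathbb Z$-shifts. An *Arnoux–Rauzy shift over $r$ letters* is the S-adic limit set of a sequence $(i_t)$ which is not eventually constant (i.e. at least two distinct substitutions occur infinitely often). A *Sturmian shift* is a nonempty minimal $\mathbb Z$-shift over two letters having exactly $n+1$ words of length $n$ for every $n\in\mathbb N$. Then, for every metric inducing the topology: 1. every Arnoux–Rauzy shift over $r$ letters is positively $r$-expansive and not positively $(r-1)$-expansive; 2. the same holds for the S-adic shift (in the sense of languages) of every sequence $(i_t)$ in which each of the $r$ letters occurs infinitely often; 3. every Sturmian shift is positively $2$-expansive and not positively $1$-expansive. -/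

import Mathlib

open SymbolicDynamics.FullShift

/-! ### Positive `n`-expansiveness -/

/-- The dynamical system `(X, f)` on the metric space `(X, d)` is positively `n`-expansive: for some
`ε > 0`, every set `W_ε(x) = {y | ∀ t ∈ ℕ, d (f^t x) (f^t y) < ε}` has at most `n` elements. -/
def PositivelyExpansive {X : Type*} [MetricSpace X] (f : X → X) (n : ℕ) : Prop :=
  ∃ ε : ℝ, 0 < ε ∧ ∀ x : X, {y : X | ∀ t : ℕ, dist (f^[t] x) (f^[t] y) < ε}.encard ≤ n

/-- The shift action `σ(x)_i = x_{i+1}`, restricted to a `ℤ`-shift. -/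
def shiftMap {A : Type*} [TopologicalSpace A] (X : Subshift A ℤ) : X.carrier → X.carrier :=
  (X.mapsTo 1).restrict (shift 1) X.carrier X.carrier

/-- The `ℤ`-shift `X` is positively `n`-expansive with respect to the metric `m` on `X`. -/
def ShiftPositivelyExpansive {A : Type*} [TopologicalSpace A] (X : Subshift A ℤ)
    (m : MetricSpace X.carrier) (n : ℕ) : Prop :=
  @PositivelyExpansive X.carrier m (shiftMap X) n

/-- The metric `m` induces on `X` the product topology (of the discrete topology on the
alphabet). -/
def IsCompatibleMetric {A : Type*} [TopologicalSpace A] (X : Subshift A ℤ)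
    (m : MetricSpace X.carrier) : Prop :=
  m.toPseudoMetricSpace.toUniformSpace.toTopologicalSpace = instTopologicalSpaceSubtype

/-! ### Words and substitutions -/

/-- The factor `x_i x_{i+1} ⋯ x_{j-1}` of the configuration `x` (empty if `j ≤ i`). -/
def factor {A : Type*} (x : ℤ → A) (i j : ℤ) : List A :=
  List.ofFn fun n : Fin (j - i).toNat => x (i + (n : ℕ))

/-- The composition `τ_0 τ_1 ⋯ τ_{t-1}` of the first `t` substitutions of a directive sequence. -/
def prodSubst {A : Type*} (τ : ℕ → A → List A) : ℕ → A → List A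
  | 0 => fun a => [a]
  | t + 1 => fun a => (τ t a).flatMap (prodSubst τ t)

/-- `k` is a desubstitution scheme of `x` for `τ`, and `y` is the corresponding desubstitution:
`k` is increasing and `x_{[k_s, k_{s+1})} = τ(y_s)` for all `s ∈ ℤ`. -/
def IsDesubstitution {A : Type*} (τ : A → List A) (x : ℤ → A) (k : ℤ → ℤ) (y : ℤ → A) : Prop :=
  StrictMono k ∧ ∀ s : ℤ, factor x (k s) (k (s + 1)) = τ (y s)

/-- The set of configurations which admit a desubstitution for `τ`. -/
def desubstitutable {A : Type*} (τ : A → List A) : Set (ℤ → A) :=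
  {x | ∃ k y, IsDesubstitution τ x k y}

/-- The S-adic limit set `Ω = ⋂_t τ_0 ⋯ τ_{t-1} (A^ℤ)`. -/
def limitSet {A : Type*} (τ : ℕ → A → List A) : Set (ℤ → A) :=
  ⋂ t : ℕ, desubstitutable (prodSubst τ t)

/-- The configurations all of whose factors appear in some `τ_0 ⋯ τ_{t-1}(a)`. -/
def sadicSet {A : Type*} (τ : ℕ → A → List A) : Set (ℤ → A) :=
  {x | ∀ i j : ℤ, ∃ t a, factor x i j <:+: prodSubst τ t a}

/-! ### The two sets above are `ℤ`-shifts -/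

theorem factor_shift {A : Type*} (x : ℤ → A) (g i j : ℤ) :
    factor (shift g x) i j = factor x (g + i) (g + j) := by
  have h : g + j - (g + i) = j - i := by ring
  simp only [factor, shift_apply]
  rw [h]
  simp only [add_assoc]

theorem mapsTo_desubstitutable {A : Type*} (τ : A → List A) (g : ℤ) :
    Set.MapsTo (shift g) (desubstitutable τ) (desubstitutable τ) := by
  rintro x ⟨k, y, hk, h⟩
  refine ⟨fun s => k s - g, y, fun a b hab => sub_lt_sub_right (hk hab) g, fun s => ?_⟩
  simpa [factor_shift] using h s

theorem isClosed_factor {A : Type*} [TopologicalSpace A] [DiscreteTopology A] (i j : ℤ)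
    (L : Set (List A)) : IsClosed {x : ℤ → A | factor x i j ∈ L} := by
  have hc : Continuous fun (x : ℤ → A) (n : Fin (j - i).toNat) => x (i + (n : ℕ)) := by fun_prop
  exact (isClosed_discrete {f : Fin (j - i).toNat → A | List.ofFn f ∈ L}).preimage hc

theorem isClosed_isDesubstitution {A : Type*} [TopologicalSpace A] [DiscreteTopology A]
    (τ : A → List A) :
    IsClosed {p : (ℤ → A) × (ℤ → ℤ) × (ℤ → A) | IsDesubstitution τ p.1 p.2.1 p.2.2} := by
  have e : {p : (ℤ → A) × (ℤ → ℤ) × (ℤ → A) | IsDesubstitution τ p.1 p.2.1 p.2.2} =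
      (⋂ (a : ℤ) (b : ℤ) (_ : a < b), {p | p.2.1 a < p.2.1 b}) ∩
      ⋂ (s : ℤ) (i : ℤ) (j : ℤ) (c : A), ({p | p.2.1 s ∈ ({i}ᶜ : Set ℤ)} ∪
        {p | p.2.1 (s + 1) ∈ ({j}ᶜ : Set ℤ)} ∪ {p | p.2.2 s ∈ ({c}ᶜ : Set A)} ∪
        {p | factor p.1 i j ∈ ({τ c} : Set (List A))}) := by
    ext p
    simp only [IsDesubstitution, StrictMono, Set.mem_ofPred_eq, Set.mem_inter_iff, Set.mem_iInter,
      Set.mem_union, Set.mem_compl_iff, Set.mem_singleton_iff]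
    refine and_congr Iff.rfl ⟨fun h s i j c => ?_, fun h s => ?_⟩
    · by_cases h1 : p.2.1 s = i
      · by_cases h2 : p.2.1 (s + 1) = j
        · by_cases h3 : p.2.2 s = c
          · right; rw [← h1, ← h2, ← h3]; exact h s
          · exact Or.inl (Or.inr h3)
        · exact Or.inl (Or.inl (Or.inr h2))
      · exact Or.inl (Or.inl (Or.inl h1))
    · simpa using h s (p.2.1 s) (p.2.1 (s + 1)) (p.2.2 s)
  rw [e]
  refine IsClosed.inter ?_ ?_
  · refine isClosed_iInter fun a => isClosed_iInter fun b => isClosed_iInter fun _ => ?_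
    exact (isClosed_discrete {q : ℤ × ℤ | q.1 < q.2}).preimage
      (f := fun p : (ℤ → A) × (ℤ → ℤ) × (ℤ → A) => (p.2.1 a, p.2.1 b)) (by fun_prop)
  · refine isClosed_iInter fun s => isClosed_iInter fun i => isClosed_iInter fun j =>
      isClosed_iInter fun c => ((IsClosed.union ?_ ?_).union ?_).union ?_
    · exact (isClosed_discrete _).preimage
        (f := fun p : (ℤ → A) × (ℤ → ℤ) × (ℤ → A) => p.2.1 s) (by fun_prop)
    · exact (isClosed_discrete _).preimage
        (f := fun p : (ℤ → A) × (ℤ → ℤ) × (ℤ → A) => p.2.1 (s + 1)) (by fun_prop)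
    · exact (isClosed_discrete _).preimage
        (f := fun p : (ℤ → A) × (ℤ → ℤ) × (ℤ → A) => p.2.2 s) (by fun_prop)
    · exact (isClosed_factor i j _).preimage continuous_fst

theorem isClosed_desubstitutable {A : Type*} [TopologicalSpace A] [DiscreteTopology A] [Finite A]
    (τ : A → List A) : IsClosed (desubstitutable τ) := by
  obtain ⟨M, hM⟩ : ∃ M : ℕ, ∀ a, (τ a).length ≤ M := by
    obtain ⟨M, hM⟩ := (Set.finite_range fun a => (τ a).length).bddAbove
    exact ⟨M, fun a => hM ⟨a, rfl⟩⟩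
  let S : Set ((ℤ → A) × (ℤ → ℤ) × (ℤ → A)) := Set.univ ×ˢ
    (Set.pi Set.univ fun s : ℤ => Set.Icc (-(M * (|s| + 1)) : ℤ) (M * (|s| + 1))) ×ˢ Set.univ
  have hS : IsCompact S := isCompact_univ.prod
    ((isCompact_univ_pi fun s => isCompact_Icc).prod isCompact_univ)
  have e : desubstitutable τ =
      Prod.fst '' (S ∩ {p | IsDesubstitution τ p.1 p.2.1 p.2.2}) := by
    ext x
    constructor
    · rintro ⟨k, y, hk, h⟩
      have gap : ∀ s, k (s + 1) - k s ≤ M := by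
        intro s
        have h1 := congrArg List.length (h s)
        have h2 := hM (y s)
        simp only [factor, List.length_ofFn] at h1
        omega
      have lt : ∀ s, k s + 1 ≤ k (s + 1) := fun s => hk (lt_add_one s)
      have up : ∀ n : ℕ, ∀ s, k s + n ≤ k (s + n) ∧ k (s + n) ≤ k s + M * n := by
        intro n
        induction n with
        | zero => intro s; simp
        | succ n ih =>
          intro s
          have h1 := ih s
          have h2 := lt (s + n)
          have h3 := gap (s + n)
          have h4 : s + ((n + 1 : ℕ) : ℤ) = s + n + 1 := by push_cast; ring
          rw [h4]
          push_cast
          constructor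
          · omega
          · linarith
      obtain ⟨s0, hs0, hmax⟩ : ∃ s0, k s0 ≤ 0 ∧ ∀ z, k z ≤ 0 → z ≤ s0 := by
        refine Int.exists_greatest_of_bdd ⟨(k 0).natAbs, fun z hz => ?_⟩
          ⟨-((k 0).natAbs : ℤ), ?_⟩
        · by_contra! hlt
          have h1 := (up z.toNat 0).1
          have h2 : (0 : ℤ) + z.toNat = z := by omega
          rw [h2] at h1
          omega
        · have h1 := (up (k 0).natAbs (-((k 0).natAbs : ℤ))).1
          rw [neg_add_cancel] at h1
          omega
      have hs1 : -(M : ℤ) ≤ k s0 := by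
        by_contra! hlt
        have h1 := gap s0
        have h2 := hmax (s0 + 1) (by omega)
        omega
      refine ⟨(x, fun s => k (s + s0), fun s => y (s + s0)), ⟨⟨trivial, ?_, trivial⟩, ?_, ?_⟩, rfl⟩
      · intro s _
        simp only [Set.mem_Icc]
        rcases le_total 0 s with hs | hs
        · have h1 := up s.toNat s0
          have h2 : s0 + (s.toNat : ℤ) = s + s0 := by omega
          have h3 : (s.toNat : ℤ) = s := by omega
          rw [h2, h3] at h1
          rw [abs_of_nonneg hs]
          have h4 : (0 : ℤ) ≤ M * s := by positivity
          constructor <;> nlinarith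
        · have h1 := up (-s).toNat (s + s0)
          have h2 : s + s0 + ((-s).toNat : ℤ) = s0 := by omega
          have h3 : ((-s).toNat : ℤ) = -s := by omega
          rw [h2, h3] at h1
          rw [abs_of_nonpos hs]
          have h4 : (0 : ℤ) ≤ M * (-s) := mul_nonneg (by positivity) (by omega)
          constructor <;> nlinarith
      · exact fun a b hab => hk (by omega)
      · intro s
        have h1 : s + 1 + s0 = s + s0 + 1 := by ring
        simpa only [h1] using h (s + s0)
    · rintro ⟨p, ⟨-, hp⟩, rfl⟩
      exact ⟨_, _, hp⟩
  rw [e]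
  exact ((hS.inter_right (isClosed_isDesubstitution τ)).image continuous_fst).isClosed

/-- The S-adic limit set of a directive sequence on a finite alphabet, as a `ℤ`-shift. -/
def limitShift {A : Type*} [TopologicalSpace A] [DiscreteTopology A] [Finite A]
    (τ : ℕ → A → List A) : Subshift A ℤ where
  carrier := limitSet τ
  isClosed := isClosed_iInter fun _ => isClosed_desubstitutable _
  mapsTo g _ hx := Set.mem_iInter.2 fun t => mapsTo_desubstitutable _ g (Set.mem_iInter.1 hx t)

/-- The S-adic shift (in the sense of languages) of a directive sequence, as a `ℤ`-shift. -/
def sadicShift {A : Type*} [TopologicalSpace A] [DiscreteTopology A]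
    (τ : ℕ → A → List A) : Subshift A ℤ where
  carrier := sadicSet τ
  isClosed := by
    have e : sadicSet τ = ⋂ (i : ℤ) (j : ℤ),
        {x | factor x i j ∈ {w : List A | ∃ t a, w <:+: prodSubst τ t a}} := by
      ext x; simp [sadicSet]
    rw [e]
    exact isClosed_iInter fun i => isClosed_iInter fun j => isClosed_factor i j _
  mapsTo g x hx i j := by
    rw [factor_shift x]
    exact hx _ _

/-! ### Arnoux–Rauzy shifts and Sturmian shifts -/

/-- The Arnoux–Rauzy substitution `τ_i`, which maps `i` to `i` and each other letter `j` to
`i j`. -/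
def arnouxRauzySubst {r : ℕ} (i j : Fin r) : List (Fin r) :=
  if j = i then [i] else [i, j]

/-- The directive sequence `(τ_{i_t})_t` is aperiodic: no letter `a` satisfies `i_t = a` for all
large `t`, that is, at least two distinct substitutions occur infinitely often. -/
def IsAperiodicDirective {r : ℕ} (i : ℕ → Fin r) : Prop :=
  ¬ ∃ a : Fin r, ∀ᶠ t in Filter.atTop, i t = a

/-- `X` is an Arnoux–Rauzy shift over `r` letters. -/
def IsArnouxRauzyShift {r : ℕ} (X : Subshift (Fin r) ℤ) : Prop :=
  ∃ i : ℕ → Fin r, IsAperiodicDirective i ∧ X = limitShift fun t => arnouxRauzySubst (i t)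

/-- `X` is a Sturmian shift: a minimal `ℤ`-shift over two letters which has exactly `n + 1` words of
length `n`, for all `n`. -/
def IsSturmianShift (X : Subshift (Fin 2) ℤ) : Prop :=
  X.carrier.Nonempty ∧
  (∀ Y : Subshift (Fin 2) ℤ, Y.carrier ⊆ X.carrier → Y.carrier.Nonempty →
    Y.carrier = X.carrier) ∧
  ∀ n : ℕ, ((fun x => factor x 0 n) '' X.carrier).ncard = n + 1

/-! ### Positive expansiveness in terms of left extensions of right rays -/

/-! By compactness, positive `n`-expansiveness depends only on left extensions of right rays. For
small `ε`, staying `ε`-close under all forward shifts forces equality on `[0, ∞)`; conversely,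
points that agree on a right ray become and stay `ε`-close after a shift. So it is enough that every
right ray has at most `r` left extensions, and that some `r` points share a right ray
(`shiftPositivelyExpansive_of_encard_le`, `not_shiftPositivelyExpansive_of_injective`).

For the upper bound, suppose a point can branch off from other points at only one position. Then all
left extensions of a ray split at the same place and are told apart by the letter just before it
(`encard_left_extensions_le`).

In the limit set, the cuts of a `τ_i`-desubstitution are the occurrences of `i`, so a branching sits
at a cut and lifts to the desubstitutions (`Branch.desubstitution`). Hence a branching position is a
cut at every level `t`. The level-`t` blocks ending there get arbitrarily long, which leaves no room
for a second branching position nearby (`Branch.unique`). For the lower bound, images of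
configurations that differ only at `-1` still differ just before a common right ray, because every
substitution preserves last letters; compactness in `t` concludes (`exists_left_extensions`).

The S-adic shift in the sense of languages lies in the limit set, which gives the upper bound; when
all letters recur, it contains the branching points of the limit set (`Branch.mem_sadicSet`).

For Sturmian shifts, the count `n + 1` leaves exactly one word of each length with two left
extensions, so all branchings have the same right ray (`Branch.eq_of_ncard_words`). Two branching
positions in one point would make it eventually periodic, against minimality and the count. -/

theorem shiftMap_iterate_apply {A : Type*} [TopologicalSpace A] (X : Subshift A ℤ) (t : ℕ)
    (x : X.carrier) (k : ℤ) : ((shiftMap X)^[t] x : ℤ → A) k = (x : ℤ → A) (t + k) := by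
  induction t generalizing x with
  | zero => simp
  | succ t ih =>
    rw [Function.iterate_succ_apply, ih]
    exact congrArg (x : ℤ → A) (show 1 + ((t : ℤ) + k) = ((t + 1 : ℕ) : ℤ) + k by push_cast; ring)

theorem compactSpace_subshift {A : Type*} [TopologicalSpace A] [Finite A] (X : Subshift A ℤ) :
    CompactSpace X.carrier :=
  isCompact_iff_compactSpace.1 X.isClosed.isCompact

/-- If each right ray has at most `n` left extensions in `X`, then `X` is positively
`n`-expansive. -/
theorem shiftPositivelyExpansive_of_encard_le {A : Type*} [TopologicalSpace A]
    [DiscreteTopology A] [Finite A] {X : Subshift A ℤ} {m : MetricSpace X.carrier}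
    (hm : IsCompatibleMetric X m) {n : ℕ}
    (h : ∀ x ∈ X.carrier, {y ∈ X.carrier | ∀ k : ℤ, 0 ≤ k → y k = x k}.encard ≤ n) :
    ShiftPositivelyExpansive X m n := by
  classical
  -- The letter at 0, coded as a natural number, is a uniformly continuous real function; codes at
  -- distance less than 1 are equal.
  obtain ⟨N, e, he⟩ : ∃ (N : ℕ) (e : A → Fin N), Function.Injective e := by
    have := Fintype.ofFinite A
    exact ⟨_, Fintype.equivFin A, (Fintype.equivFin A).injective⟩
  have hc : @Continuous _ _ m.toPseudoMetricSpace.toUniformSpace.toTopologicalSpace _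
      fun x : X.carrier => ((e ((x : ℤ → A) 0) : ℕ) : ℝ) := by
    rw [show m.toPseudoMetricSpace.toUniformSpace.toTopologicalSpace = _ from hm]
    have h1 : Continuous fun a : A => ((e a : ℕ) : ℝ) := continuous_of_discreteTopology
    exact h1.comp ((continuous_apply 0).comp continuous_subtype_val)
  have hcomp : @CompactSpace X.carrier
      m.toPseudoMetricSpace.toUniformSpace.toTopologicalSpace := by
    rw [show m.toPseudoMetricSpace.toUniformSpace.toTopologicalSpace = _ from hm]
    exact compactSpace_subshift X
  have hu := @CompactSpace.uniformContinuous_of_continuous _ _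
    m.toPseudoMetricSpace.toUniformSpace _ hcomp _ hc
  obtain ⟨ε, hε, hd⟩ := (@Metric.uniformContinuous_iff _ _ m.toPseudoMetricSpace _ _).1 hu 1 one_pos
  refine ⟨ε, hε, fun x => ?_⟩
  rw [← Subtype.val_injective.encard_image]
  refine le_trans (Set.encard_le_encard ?_) (h x x.2)
  rintro _ ⟨y, hy, rfl⟩
  refine ⟨y.2, fun k hk => ?_⟩
  have h1 := hd (hy k.toNat)
  rw [shiftMap_iterate_apply, shiftMap_iterate_apply, Int.toNat_of_nonneg hk, add_zero,
    Real.dist_eq, ← Int.cast_natCast (R := ℝ), ← Int.cast_natCast (R := ℝ), ← Int.cast_sub,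
    ← Int.cast_abs] at h1
  have h2 : |((e ((x : ℤ → A) k) : ℕ) : ℤ) - ((e ((y : ℤ → A) k) : ℕ) : ℤ)| < 1 := by
    exact_mod_cast h1
  rw [Int.abs_lt_one_iff] at h2
  exact (he (Fin.ext (by omega))).symm

/-- In a `ℤ`-shift, points which agree on a large window are close. -/
theorem exists_window_dist_lt {A : Type*} [TopologicalSpace A]
    [DiscreteTopology A] [Finite A] {X : Subshift A ℤ} {m : MetricSpace X.carrier}
    (hm : IsCompatibleMetric X m) {ε : ℝ} (hε : 0 < ε) :
    ∃ N : ℕ, ∀ x y : X.carrier,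
      (∀ k : ℤ, -N ≤ k → (x : ℤ → A) k = (y : ℤ → A) k) → dist x y < ε := by
  have hX := compactSpace_subshift X
  -- The sets `K N` of bad pairs are compact, decreasing and nonempty; a common element would be a
  -- pair of equal points at distance at least `ε`.
  by_contra! hcon
  let K : ℕ → Set (X.carrier × X.carrier) := fun N =>
    {p | (∀ k : ℤ, -N ≤ k → (p.1 : ℤ → A) k = (p.2 : ℤ → A) k) ∧ ε ≤ dist p.1 p.2}
  have hdist : Continuous fun p : X.carrier × X.carrier => dist p.1 p.2 := by
    have h := @continuous_dist _ m.toPseudoMetricSpace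
    rwa [show m.toPseudoMetricSpace.toUniformSpace.toTopologicalSpace = _ from hm] at h
  have hcl : ∀ N, IsClosed (K N) := by
    intro N
    refine IsClosed.inter (s₁ := {p | ∀ k : ℤ, -N ≤ k → (p.1 : ℤ → A) k = (p.2 : ℤ → A) k}) ?_
      (isClosed_le continuous_const hdist)
    simp only [Set.ofPred_forall]
    refine isClosed_iInter fun k => isClosed_iInter fun _ => isClosed_eq ?_ ?_
    · exact (continuous_apply k).comp (continuous_subtype_val.comp continuous_fst)
    · exact (continuous_apply k).comp (continuous_subtype_val.comp continuous_snd)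
  obtain ⟨p, hp⟩ := IsCompact.nonempty_iInter_of_sequence_nonempty_isCompact_isClosed K
    (fun N p hp => ⟨fun k hk => hp.1 k (by push_cast; omega), hp.2⟩)
    (fun N => by
      obtain ⟨x, y, h1, h2⟩ := hcon N
      exact ⟨(x, y), h1, h2⟩) (hcl 0).isCompact hcl
  rw [Set.mem_iInter] at hp
  have h1 : p.1 = p.2 := by
    ext k
    exact (hp k.natAbs).1 k (by omega)
  have h2 := (hp 0).2
  rw [h1, dist_self] at h2
  exact absurd hε (not_lt.2 h2)

/-- If some `n + 1` points of `X` agree on a right ray, then `X` is not positively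
`n`-expansive. -/
theorem not_shiftPositivelyExpansive_of_injective {A : Type*} [TopologicalSpace A]
    [DiscreteTopology A] [Finite A] {X : Subshift A ℤ} {m : MetricSpace X.carrier}
    (hm : IsCompatibleMetric X m) {n r : ℕ} (hr : n < r) (f : Fin r → ℤ → A)
    (hf : Function.Injective f) (hX : ∀ a, f a ∈ X.carrier)
    (hray : ∀ a b, ∀ k : ℤ, 0 ≤ k → f a k = f b k) : ¬ ShiftPositivelyExpansive X m n := by
  rintro ⟨ε, hε, h⟩
  obtain ⟨N, hN⟩ := exists_window_dist_lt hm hε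
  -- The shift by `N` turns agreement on `[0, ∞)` into agreement on `[-N, ∞)`, which forward shifts
  -- preserve.
  let g : Fin r → X.carrier := fun a => ⟨shift (N : ℤ) (f a), X.mapsTo _ (hX a)⟩
  have hg : Function.Injective g := by
    intro a b hab
    refine hf (funext fun k => ?_)
    have h1 := congrFun (congrArg Subtype.val hab) (k - N)
    simpa [g, shift_apply] using h1
  have h1 : Set.range g ⊆ {y | ∀ t : ℕ,
      dist ((shiftMap X)^[t] (g ⟨0, by omega⟩)) ((shiftMap X)^[t] y) < ε} := by
    rintro _ ⟨a, rfl⟩ t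
    refine hN _ _ fun k hk => ?_
    rw [shiftMap_iterate_apply, shiftMap_iterate_apply]
    exact hray _ _ _ (by omega)
  have h2 := (Set.encard_le_encard h1).trans (h _)
  rw [← Set.image_univ, hg.encard_image, Set.encard_univ] at h2
  simp only [ENat.card_eq_coe_fintype_card, Fintype.card_fin, Nat.cast_le] at h2
  omega

/-! ### Factors and desubstitutions -/

section Desubstitution

variable {A : Type*}

theorem length_factor (x : ℤ → A) (i j : ℤ) : (factor x i j).length = (j - i).toNat := by
  simp [factor]

theorem getElem?_factor (x : ℤ → A) {i j n : ℤ} (h : i ≤ n) (h' : n < j) :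
    (factor x i j)[(n - i).toNat]? = some (x n) := by
  have h1 : (n - i).toNat < (j - i).toNat := by omega
  have h2 : i + ((n - i).toNat : ℤ) = n := by omega
  simp [factor, h1, h2, -Int.ofNat_toNat]

theorem factor_congr {x x' : ℤ → A} {i j i' j' : ℤ} (hij : j - i = j' - i')
    (h : ∀ n : ℕ, (n : ℤ) < j - i → x (i + n) = x' (i' + n)) : factor x i j = factor x' i' j' := by
  unfold factor
  rw [hij]
  refine congrArg List.ofFn (funext fun n => ?_)
  have := n.2
  exact h n (by omega)

theorem eq_of_factor_eq {x x' : ℤ → A} {i j i' j' : ℤ} (h : factor x i j = factor x' i' j')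
    {n : ℕ} (hn : (n : ℤ) < j - i) : x (i + n) = x' (i' + n) := by
  have h1 := congrArg List.length h
  rw [length_factor, length_factor] at h1
  have h2 := getElem?_factor x (i := i) (j := j) (n := i + n) (by omega) (by omega)
  have h3 := getElem?_factor x' (i := i') (j := j') (n := i' + n) (by omega) (by omega)
  rw [add_sub_cancel_left] at h2 h3
  rw [h, h3] at h2
  exact (Option.some_injective _ h2).symm

theorem factor_append (x : ℤ → A) {i j l : ℤ} (hij : i ≤ j) (hjl : j ≤ l) :
    factor x i j ++ factor x j l = factor x i l := by
  apply List.ext_getElem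
  · simp only [List.length_append, length_factor]
    omega
  · intro n h1 h2
    rw [List.getElem_append]
    simp only [factor, List.getElem_ofFn, List.length_ofFn]
    split_ifs with h
    · rfl
    · rw [show j + ((n - (j - i).toNat : ℕ) : ℤ) = i + n by omega]

theorem factor_self (x : ℤ → A) (i : ℤ) : factor x i i = [] := by
  simp [factor]

theorem factor_add_one (x : ℤ → A) (i : ℤ) : factor x i (i + 1) = [x i] := by
  have h : (i + 1 - i).toNat = 1 := by omega
  unfold factor
  rw [h]
  simp

theorem factor_isInfix (x : ℤ → A) {i j k l : ℤ} (hij : i ≤ j) (hki : k ≤ i) (hjl : j ≤ l) :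
    factor x i j <:+: factor x k l :=
  ⟨factor x k i, factor x j l, by
    rw [factor_append x hki hij, factor_append x (hki.trans hij) hjl]⟩

/-- The positions of a desubstitution scheme cut `ℤ` into consecutive intervals. -/
theorem StrictMono.exists_int_mem_Ico {k : ℤ → ℤ} (hk : StrictMono k) (n : ℤ) :
    ∃ s, k s ≤ n ∧ n < k (s + 1) := by
  have up : ∀ (m : ℕ) (s : ℤ), k s + m ≤ k (s + m) := by
    intro m s
    induction m with
    | zero => simp
    | succ m ih =>
      have h1 : k (s + m) < k (s + (m + 1 : ℕ)) := hk (by push_cast; omega)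
      push_cast at h1 ⊢
      omega
  obtain ⟨s, hs, hmax⟩ : ∃ s, k s ≤ n ∧ ∀ z, k z ≤ n → z ≤ s := by
    refine Int.exists_greatest_of_bdd ⟨(n - k 0).toNat, fun z hz => ?_⟩
      ⟨-((k 0 - n).toNat : ℤ), ?_⟩
    · by_contra! hlt
      have h1 := up z.toNat 0
      have h2 : (0 : ℤ) + z.toNat = z := by omega
      rw [h2] at h1
      omega
    · have h1 := up (k 0 - n).toNat (-((k 0 - n).toNat : ℤ))
      rw [neg_add_cancel] at h1
      omega
  exact ⟨s, hs, not_le.1 fun h => by have := hmax _ h; omega⟩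

theorem IsDesubstitution.length_eq {ρ : A → List A} {x y : ℤ → A} {k : ℤ → ℤ}
    (h : IsDesubstitution ρ x k y) (s : ℤ) : k (s + 1) = k s + (ρ (y s)).length := by
  have h1 := congrArg List.length (h.2 s)
  have h2 := h.1 (lt_add_one s)
  rw [length_factor] at h1
  omega

theorem IsDesubstitution.getElem? {ρ : A → List A} {x y : ℤ → A} {k : ℤ → ℤ}
    (h : IsDesubstitution ρ x k y) {s n : ℤ} (h1 : k s ≤ n) (h2 : n < k (s + 1)) :
    (ρ (y s))[(n - k s).toNat]? = some (x n) := by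
  rw [← h.2 s, getElem?_factor x h1 h2]

/-- Two configurations with desubstitutions that agree to the right of a common cut agree to the
right of this cut. -/
theorem IsDesubstitution.eq_of_ge {ρ : A → List A} {x y x' y' : ℤ → A} {k k' : ℤ → ℤ}
    (h : IsDesubstitution ρ x k y) (h' : IsDesubstitution ρ x' k' y') {s : ℤ} (hk : k s = k' s)
    (hy : ∀ u, s ≤ u → y u = y' u) {n : ℤ} (hn : k s ≤ n) : x n = x' n := by
  have key : ∀ u, s ≤ u → k u = k' u := by
    intro u hu
    induction u, hu using Int.leInduction with
    | base => exact hk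
    | succ u hu ih => rw [h.length_eq, h'.length_eq, ih, hy u hu]
  obtain ⟨u, hu, hu'⟩ := h.1.exists_int_mem_Ico n
  have hsu : s ≤ u := by
    have := h.1.lt_iff_lt.1 (hn.trans_lt hu')
    omega
  have e1 := h.getElem? hu hu'
  rw [key u hsu] at hu
  rw [key (u + 1) (by omega)] at hu'
  have e2 := h'.getElem? hu hu'
  rw [← hy u hsu, ← key u hsu, e1] at e2
  exact Option.some_injective _ e2

/-- One cut and the block lengths determine all cuts; the blocks then determine the configuration.
-/
theorem IsDesubstitution.unique {ρ : A → List A} {x y x' : ℤ → A} {k k' : ℤ → ℤ}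
    (h : IsDesubstitution ρ x k y) (h' : IsDesubstitution ρ x' k' y) (h0 : k 0 = k' 0) :
    k = k' ∧ x = x' := by
  have key : ∀ u, k u = k' u := by
    intro u
    induction u using Int.induction_on with
    | zero => exact h0
    | succ u ih => rw [h.length_eq, h'.length_eq, ih]
    | pred u ih =>
      have h1 := h.length_eq (-u - 1)
      have h2 := h'.length_eq (-u - 1)
      rw [sub_add_cancel] at h1 h2
      omega
  refine ⟨funext key, funext fun n => ?_⟩
  obtain ⟨u, hu, -⟩ := h.1.exists_int_mem_Ico n
  exact h.eq_of_ge h' (key u) (fun _ _ => rfl) hu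

theorem exists_int_partial_sums (L : ℤ → ℤ) (p : ℤ) :
    ∃ k : ℤ → ℤ, k 0 = p ∧ ∀ s, k (s + 1) = k s + L s := by
  refine ⟨fun s => p + ∑ j ∈ Finset.Ico 0 s, L j - ∑ j ∈ Finset.Ico s 0, L j, by simp, fun s => ?_⟩
  rcases le_or_gt 0 s with hs | hs
  · have h1 : Finset.Ico 0 (s + 1) = insert s (Finset.Ico 0 s) := by
      ext j
      simp only [Finset.mem_Ico, Finset.mem_insert]
      omega
    have h2 : Finset.Ico s 0 = ∅ := Finset.Ico_eq_empty (by omega)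
    have h3 : Finset.Ico (s + 1) 0 = ∅ := Finset.Ico_eq_empty (by omega)
    simp only [h1, h2, h3, Finset.sum_empty]
    rw [Finset.sum_insert (by simp)]
    ring
  · have h1 : Finset.Ico s 0 = insert s (Finset.Ico (s + 1) 0) := by
      ext j
      simp only [Finset.mem_Ico, Finset.mem_insert]
      omega
    have h2 : Finset.Ico 0 s = ∅ := Finset.Ico_eq_empty (by omega)
    have h3 : Finset.Ico 0 (s + 1) = ∅ := Finset.Ico_eq_empty (by omega)
    simp only [h1, h2, h3, Finset.sum_empty]
    rw [Finset.sum_insert (by simp)]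
    ring

/-- Every configuration has an image under a nonerasing substitution. -/
theorem exists_isDesubstitution {ρ : A → List A} (hρ : ∀ a, ρ a ≠ []) (y : ℤ → A) (p : ℤ) :
    ∃ x k, k 0 = p ∧ IsDesubstitution ρ x k y := by
  obtain ⟨k, h0, hk⟩ := exists_int_partial_sums (fun s => (ρ (y s)).length) p
  have hpos : ∀ s, 0 < (ρ (y s)).length := fun s => List.length_pos_iff.2 (hρ _)
  have hmono : StrictMono k := strictMono_int_of_lt_succ fun s => by
    rw [hk]
    have := hpos s
    omega
  choose c hc hc' using hmono.exists_int_mem_Ico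
  have huniq : ∀ n s, k s ≤ n → n < k (s + 1) → c n = s := by
    intro n s h1 h2
    have h3 := hmono.lt_iff_lt.1 (h1.trans_lt (hc' n))
    have h4 := hmono.lt_iff_lt.1 ((hc n).trans_lt h2)
    omega
  -- The default `y 0` is never read: `c n` is the index of the block that contains `n`.
  refine ⟨fun n => (ρ (y (c n))).getD (n - k (c n)).toNat (y 0), k, h0, hmono, fun s => ?_⟩
  apply List.ext_getElem
  · rw [length_factor, hk]
    omega
  · intro n h1 h2
    rw [length_factor] at h1
    have h3 : c (k s + n) = s := huniq _ _ (by omega) (by omega)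
    simp [factor, h3, h2]

theorem IsDesubstitution.factor_eq_flatMap {ρ : A → List A} {x y : ℤ → A} {k : ℤ → ℤ}
    (h : IsDesubstitution ρ x k y) {i j : ℤ} (hij : i ≤ j) :
    factor x (k i) (k j) = (factor y i j).flatMap ρ := by
  induction j, hij using Int.leInduction with
  | base => simp [factor_self]
  | succ j hij ih =>
    rw [← factor_append y hij (by omega : j ≤ j + 1), List.flatMap_append, ← ih, factor_add_one,
      List.flatMap_singleton, ← h.2 j,
      factor_append x (h.1.monotone hij) (h.1.monotone (by omega))]

theorem IsDesubstitution.comp {ρ σ : A → List A} {x y z : ℤ → A} {k l : ℤ → ℤ}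
    (h : IsDesubstitution ρ x k y) (h' : IsDesubstitution σ y l z) :
    IsDesubstitution (fun a => (σ a).flatMap ρ) x (k ∘ l) z :=
  ⟨h.1.comp h'.1, fun s => by
    rw [Function.comp_apply, Function.comp_apply,
      h.factor_eq_flatMap (h'.1.monotone (by omega)), h'.2 s]⟩

/-- A desubstitution for a composition of nonerasing substitutions can be done in two steps. -/
theorem IsDesubstitution.split {ρ σ : A → List A} (hρ : ∀ a, ρ a ≠ []) (hσ : ∀ a, σ a ≠ [])
    {x z : ℤ → A} {k : ℤ → ℤ} (h : IsDesubstitution (fun a => (σ a).flatMap ρ) x k z) :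
    ∃ l y m, IsDesubstitution ρ x l y ∧ IsDesubstitution σ y m z ∧ k = l ∘ m := by
  -- The two-step image of `z`, anchored at `k 0`, has the same desubstitution as `x`, so uniqueness
  -- identifies the two.
  obtain ⟨y, m, hm0, hy⟩ := exists_isDesubstitution hσ z 0
  obtain ⟨x', l, hl0, hx⟩ := exists_isDesubstitution hρ y (k 0)
  obtain ⟨h1, rfl⟩ := h.unique (hx.comp hy) (by simp [hm0, hl0])
  exact ⟨l, y, m, hx, hy, h1⟩

end Desubstitution

/-! ### Arnoux–Rauzy substitutions -/

section ArnouxRauzy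

variable {r : ℕ}

theorem arnouxRauzySubst_eq_cons (i j : Fin r) :
    arnouxRauzySubst i j = i :: if j = i then [] else [j] := by
  unfold arnouxRauzySubst
  split_ifs <;> rfl

theorem arnouxRauzySubst_eq_append (i j : Fin r) :
    arnouxRauzySubst i j = (if j = i then [] else [i]) ++ [j] := by
  unfold arnouxRauzySubst
  split_ifs with h
  · simp [h]
  · rfl

theorem arnouxRauzySubst_ne_nil (i j : Fin r) : arnouxRauzySubst i j ≠ [] := by
  simp [arnouxRauzySubst_eq_cons]

theorem IsDesubstitution.apply_cut {i : Fin r} {x y : ℤ → Fin r} {k : ℤ → ℤ}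
    (h : IsDesubstitution (arnouxRauzySubst i) x k y) (s : ℤ) : x (k s) = i := by
  have h1 := h.getElem? le_rfl (h.1 (lt_add_one s))
  rw [sub_self, arnouxRauzySubst_eq_cons] at h1
  simpa using h1.symm

/-- In `i` and `i j` with `j ≠ i`, the letter `i` occurs only at the start. With `apply_cut`, the
cuts are exactly the occurrences of `i`. -/
theorem IsDesubstitution.exists_cut {i : Fin r} {x y : ℤ → Fin r} {k : ℤ → ℤ}
    (h : IsDesubstitution (arnouxRauzySubst i) x k y) {n : ℤ} (hn : x n = i) : ∃ s, k s = n := by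
  obtain ⟨s, h1, h2⟩ := h.1.exists_int_mem_Ico n
  refine ⟨s, h1.antisymm (not_lt.1 fun hlt => ?_)⟩
  have h3 := h.getElem? h1 h2
  have h4 := h.length_eq s
  rw [arnouxRauzySubst] at h3 h4
  split_ifs at h3 h4 with hy
  · simp at h4
    omega
  · have h5 : (n - k s).toNat = 1 := by
      simp at h4
      omega
    rw [h5, hn] at h3
    simp at h3
    exact hy h3

/-- This reads `y` off `x` without knowing the block length: after a block `i` comes the next cut,
which again carries `i`. -/
theorem IsDesubstitution.apply_cut_add_one {i : Fin r} {x y : ℤ → Fin r} {k : ℤ → ℤ}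
    (h : IsDesubstitution (arnouxRauzySubst i) x k y) (s : ℤ) : x (k s + 1) = y s := by
  have h4 := h.length_eq s
  by_cases hy : y s = i
  · have h5 := h.apply_cut (s + 1)
    rw [arnouxRauzySubst, if_pos hy] at h4
    simp only [List.length_singleton, Nat.cast_one] at h4
    rw [← h4, h5, hy]
  · rw [arnouxRauzySubst, if_neg hy] at h4
    simp at h4
    have h3 := h.getElem? (s := s) (n := k s + 1) (by omega) (by omega)
    rw [arnouxRauzySubst, if_neg hy, add_sub_cancel_left] at h3
    simpa using h3.symm

/-- A letter other than `i` ends its block, so a cut follows. -/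
theorem IsDesubstitution.eq_of_apply_ne {i : Fin r} {x y : ℤ → Fin r} {k : ℤ → ℤ}
    (h : IsDesubstitution (arnouxRauzySubst i) x k y) {n : ℤ} (hn : x n ≠ i) : x (n + 1) = i := by
  obtain ⟨s, h1, h2⟩ := h.1.exists_int_mem_Ico n
  have h3 : k s ≠ n := fun h3 => hn (h3 ▸ h.apply_cut s)
  have h4 := h.length_eq s
  have h5 : (arnouxRauzySubst i (y s)).length ≤ 2 := by
    unfold arnouxRauzySubst
    split_ifs <;> simp
  rw [show n + 1 = k (s + 1) by omega]
  exact h.apply_cut _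

/-- Stated for any substitution preserving last letters, so that it covers the products as well. -/
theorem IsDesubstitution.apply_cut_sub_one {A : Type*} {ρ : A → List A}
    (hρ : ∀ a, (ρ a).getLast? = some a) {x y : ℤ → A} {k : ℤ → ℤ}
    (h : IsDesubstitution ρ x k y) (s : ℤ) : x (k s - 1) = y (s - 1) := by
  have h1 := h.1 (sub_one_lt s)
  have h4 := h.length_eq (s - 1)
  have h3 := h.getElem? (s := s - 1) (n := k s - 1) (by omega) (by rw [sub_add_cancel]; omega)
  rw [sub_add_cancel] at h4
  rw [show (k s - 1 - k (s - 1)).toNat = (ρ (y (s - 1))).length - 1 by omega,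
    ← List.getLast?_eq_getElem?, hρ] at h3
  exact (Option.some_injective _ h3).symm

/-! ### Branchings and their desubstitution -/

/-- The configurations `x` from `p` on and `x'` from `p'` on agree, and they differ just before. -/
def Branch {A : Type*} (x : ℤ → A) (p : ℤ) (x' : ℤ → A) (p' : ℤ) : Prop :=
  (∀ n : ℕ, x (p + n) = x' (p' + n)) ∧ x (p - 1) ≠ x' (p' - 1)

theorem Branch.symm {A : Type*} {x x' : ℤ → A} {p p' : ℤ} (h : Branch x p x' p') :
    Branch x' p' x p :=
  ⟨fun n => (h.1 n).symm, h.2.symm⟩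

theorem exists_branch {A : Type*} {x x' : ℤ → A} (h : ∀ k : ℤ, 0 ≤ k → x k = x' k) (hne : x ≠ x') :
    ∃ p, Branch x p x' p := by
  obtain ⟨k, hk⟩ := Function.ne_iff.1 hne
  obtain ⟨q, hq, hmax⟩ := Int.exists_greatest_of_bdd (P := fun k => x k ≠ x' k)
    ⟨0, fun z hz => not_lt.1 fun hlt => hz (h z hlt.le)⟩ ⟨k, hk⟩
  refine ⟨q + 1, fun n => ?_, by simpa using hq⟩
  by_contra hn
  have := hmax _ hn
  omega

/-- A branching of two configurations at positions `p`, `p'` lifts to a branching of their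
desubstitutions. -/
theorem Branch.desubstitution {i : Fin r} {x y x' y' : ℤ → Fin r} {k k' : ℤ → ℤ} {p p' : ℤ}
    (hb : Branch x p x' p') (h : IsDesubstitution (arnouxRauzySubst i) x k y)
    (h' : IsDesubstitution (arnouxRauzySubst i) x' k' y') :
    x p = i ∧ ∃ s s', k s = p ∧ k' s' = p' ∧ Branch y s y' s' := by
  have hlast : ∀ a, (arnouxRauzySubst i a).getLast? = some a := fun a => by
    simp [arnouxRauzySubst_eq_append]
  have h0 : x p = x' p' := by simpa using hb.1 0
  -- The letters before the branching differ, so one of them is not `i` and is followed by `i`.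
  have hp : x p = i := by
    by_cases h1 : x (p - 1) = i
    · have h2 := h'.eq_of_apply_ne (n := p' - 1) fun h2 => hb.2 (h1.trans h2.symm)
      rwa [sub_add_cancel, ← h0] at h2
    · simpa using h.eq_of_apply_ne h1
  obtain ⟨s, rfl⟩ := h.exists_cut hp
  obtain ⟨s', rfl⟩ := h'.exists_cut (h0 ▸ hp)
  refine ⟨hp, s, s', rfl, rfl, ?_, ?_⟩
  · have key : ∀ n : ℕ, (∃ d : ℕ, k (s + n) = k s + d ∧ k' (s' + n) = k' s' + d) ∧
        y (s + n) = y' (s' + n) := by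
      have step : ∀ n : ℕ, (∃ d : ℕ, k (s + n) = k s + d ∧ k' (s' + n) = k' s' + d) →
          y (s + n) = y' (s' + n) := by
        rintro n ⟨d, h1, h2⟩
        rw [← h.apply_cut_add_one, ← h'.apply_cut_add_one, h1, h2]
        simpa [add_assoc] using hb.1 (d + 1)
      intro n
      induction n with
      | zero =>
        have h1 : ∃ d : ℕ, k (s + (0 : ℕ)) = k s + d ∧ k' (s' + (0 : ℕ)) = k' s' + d :=
          ⟨0, by simp⟩
        exact ⟨h1, step 0 h1⟩
      | succ n ih =>
        obtain ⟨⟨d, h1, h2⟩, h3⟩ := ih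
        have h4 : ∃ d : ℕ, k (s + (n + 1 : ℕ)) = k s + d ∧ k' (s' + (n + 1 : ℕ)) = k' s' + d := by
          refine ⟨d + (arnouxRauzySubst i (y (s + n))).length, ?_, ?_⟩
          · have := h.length_eq (s + n)
            push_cast
            rw [← add_assoc, this, h1, add_assoc]
          · have := h'.length_eq (s' + n)
            push_cast
            rw [← add_assoc, this, h2, add_assoc, h3]
        exact ⟨h4, step _ h4⟩
    exact fun n => (key n).2
  · rw [← h.apply_cut_sub_one hlast, ← h'.apply_cut_sub_one hlast]
    exact hb.2

/-! ### Directive sequences -/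

/-- The products `τ_{i_0} ⋯ τ_{i_{t-1}}` of Arnoux–Rauzy substitutions. -/
abbrev arnouxRauzyProd (i : ℕ → Fin r) (t : ℕ) : Fin r → List (Fin r) :=
  prodSubst (fun t => arnouxRauzySubst (i t)) t

/-- One more level only prepends a block, and does so exactly when `a ≠ i t`. This drives the
suffix, prefix and growth statements. -/
theorem arnouxRauzyProd_succ (i : ℕ → Fin r) (t : ℕ) (a : Fin r) :
    arnouxRauzyProd i (t + 1) a =
      (if a = i t then [] else arnouxRauzyProd i t (i t)) ++ arnouxRauzyProd i t a := by
  simp only [arnouxRauzyProd, prodSubst, arnouxRauzySubst_eq_append]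
  split_ifs <;> simp

theorem getLast?_arnouxRauzyProd (i : ℕ → Fin r) (t : ℕ) (a : Fin r) :
    (arnouxRauzyProd i t a).getLast? = some a := by
  induction t with
  | zero => rfl
  | succ t ih => simp [arnouxRauzyProd_succ, List.getLast?_append, ih]

theorem arnouxRauzyProd_ne_nil (i : ℕ → Fin r) (t : ℕ) (a : Fin r) :
    arnouxRauzyProd i t a ≠ [] := by
  intro h
  have := getLast?_arnouxRauzyProd i t a
  simp [h] at this

theorem arnouxRauzyProd_suffix (i : ℕ → Fin r) {s t : ℕ} (hst : s ≤ t) (a : Fin r) :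
    arnouxRauzyProd i s a <:+ arnouxRauzyProd i t a := by
  induction t, hst using Nat.le_induction with
  | base => exact List.suffix_rfl
  | succ t _ ih =>
    rw [arnouxRauzyProd_succ]
    exact ih.trans (List.suffix_append _ _)

/-- At level `s + 1` all images begin with this word, and whatever later levels prepend begins with
it too. -/
theorem arnouxRauzyProd_prefix (i : ℕ → Fin r) {s t : ℕ} (hst : s < t) (a : Fin r) :
    arnouxRauzyProd i s (i s) <+: arnouxRauzyProd i t a := by
  induction t, hst using Nat.le_induction generalizing a with
  | base =>
    rw [arnouxRauzyProd_succ]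
    split_ifs with h
    · simp [h]
    · exact List.prefix_append _ _
  | succ t _ ih =>
    rw [arnouxRauzyProd_succ]
    split_ifs with h
    · simpa using ih a
    · exact (ih _).trans (List.prefix_append _ _)

/-- The image of `a` grows whenever `i t ≠ a`, which aperiodicity makes happen infinitely often. -/
theorem tendsto_length_arnouxRauzyProd {i : ℕ → Fin r} (hi : IsAperiodicDirective i) (a : Fin r) :
    Filter.Tendsto (fun t => (arnouxRauzyProd i t a).length) Filter.atTop Filter.atTop := by
  have hmono : Monotone fun t => (arnouxRauzyProd i t a).length :=
    fun s t hst => (arnouxRauzyProd_suffix i hst a).length_le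
  refine Filter.tendsto_atTop_atTop_of_monotone hmono fun n => ?_
  induction n with
  | zero => exact ⟨0, Nat.zero_le _⟩
  | succ n ih =>
    obtain ⟨t, ht⟩ := ih
    have h1 : ∃ s, t ≤ s ∧ i s ≠ a := by
      by_contra! hcon
      exact hi ⟨a, Filter.eventually_atTop.2 ⟨t, hcon⟩⟩
    obtain ⟨s, hs, hsa⟩ := h1
    refine ⟨s + 1, ?_⟩
    have h2 := hmono hs
    have h3 := List.length_pos_iff.2 (arnouxRauzyProd_ne_nil i s (i s))
    simp only [arnouxRauzyProd_succ, if_neg hsa.symm, List.length_append] at h2 ⊢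
    omega

theorem IsDesubstitution.split_arnouxRauzyProd {i : ℕ → Fin r} {t : ℕ} {x z : ℤ → Fin r}
    {k : ℤ → ℤ} (h : IsDesubstitution (arnouxRauzyProd i (t + 1)) x k z) :
    ∃ l y m, IsDesubstitution (arnouxRauzyProd i t) x l y ∧
      IsDesubstitution (arnouxRauzySubst (i t)) y m z ∧ k = l ∘ m :=
  h.split (arnouxRauzyProd_ne_nil i t) (arnouxRauzySubst_ne_nil (i t))

theorem desubstitutable_succ_subset (i : ℕ → Fin r) (t : ℕ) :
    desubstitutable (arnouxRauzyProd i (t + 1)) ⊆ desubstitutable (arnouxRauzyProd i t) := by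
  rintro x ⟨k, z, h⟩
  obtain ⟨l, y, m, h1, -, -⟩ := h.split_arnouxRauzyProd
  exact ⟨l, y, h1⟩

/-- In particular, a branching position is a cut at every level. -/
theorem Branch.desubstitution_prod {i : ℕ → Fin r} {t : ℕ} {x y x' y' : ℤ → Fin r} {k k' : ℤ → ℤ}
    {p p' : ℤ} (hb : Branch x p x' p') (h : IsDesubstitution (arnouxRauzyProd i t) x k y)
    (h' : IsDesubstitution (arnouxRauzyProd i t) x' k' y') :
    ∃ s s', k s = p ∧ k' s' = p' ∧ Branch y s y' s' := by
  induction t generalizing y y' k k' with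
  | zero =>
    -- At level 0 all blocks are single letters, so `y` is a translate of `x`.
    have key : ∀ {x y : ℤ → Fin r} {k : ℤ → ℤ} (p : ℤ),
        IsDesubstitution (arnouxRauzyProd i 0) x k y →
        ∃ s, k s = p ∧ ∀ n, y (s + n) = x (p + n) := by
      intro x y k p h
      have h1 : ∀ s, k (s + 1) = k s + 1 := fun s => by simpa [prodSubst] using h.length_eq s
      have h2 : ∀ s, k s = k 0 + s := by
        intro s
        induction s using Int.induction_on with
        | zero => simp
        | succ s ih => rw [h1, ih, add_assoc]
        | pred s ih =>
          have := h1 (-s - 1)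
          rw [sub_add_cancel] at this
          omega
      refine ⟨p - k 0, by rw [h2]; ring, fun n => ?_⟩
      have h3 := h.2 (p - k 0 + n)
      rw [h1, factor_add_one] at h3
      simp only [prodSubst, List.cons.injEq, and_true] at h3
      rw [← h3, h2]
      congr 1
      ring
    obtain ⟨s, hs, hs'⟩ := key p h
    obtain ⟨s', hs1, hs1'⟩ := key p' h'
    refine ⟨s, s', hs, hs1, fun n => ?_, ?_⟩
    · rw [hs', hs1']
      exact hb.1 n
    · rw [sub_eq_add_neg, sub_eq_add_neg, hs', hs1']
      exact hb.2
  | succ t ih =>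
    obtain ⟨l, w, m, h1, h2, rfl⟩ := h.split_arnouxRauzyProd
    obtain ⟨l', w', m', h1', h2', rfl⟩ := h'.split_arnouxRauzyProd
    obtain ⟨s, s', rfl, rfl, hb'⟩ := ih h1 h1'
    obtain ⟨-, u, u', rfl, rfl, hb''⟩ := hb'.desubstitution h2 h2'
    exact ⟨u, u', rfl, rfl, hb''⟩

/-! ### Left extensions of right rays in the limit set -/

/-- A configuration in the limit set branches at most at one position. -/
theorem Branch.unique {i : ℕ → Fin r} (hi : IsAperiodicDirective i) {x x' x'' : ℤ → Fin r}
    (hx : x ∈ limitSet fun t => arnouxRauzySubst (i t))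
    (hx' : x' ∈ limitSet fun t => arnouxRauzySubst (i t))
    (hx'' : x'' ∈ limitSet fun t => arnouxRauzySubst (i t))
    {p q : ℤ} (hp : Branch x p x' p) (hq : Branch x q x'' q) : p = q := by
  have key : ∀ {x' x'' : ℤ → Fin r} {p q : ℤ},
      x' ∈ limitSet (fun t => arnouxRauzySubst (i t)) →
      x'' ∈ limitSet (fun t => arnouxRauzySubst (i t)) →
      Branch x p x' p → Branch x q x'' q → p ≤ q := by
    intro x' x'' p q hx' hx'' hp hq
    by_contra! hlt
    -- At this level the block that ends just before `p` is longer than `p - q`, so the cut `q`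
    -- would fall strictly inside it.
    obtain ⟨t, ht⟩ := ((tendsto_length_arnouxRauzyProd hi (x (p - 1))).eventually_gt_atTop
      (p - q).toNat).exists
    obtain ⟨k, y, h⟩ := Set.mem_iInter.1 hx t
    obtain ⟨k', y', h'⟩ := Set.mem_iInter.1 hx' t
    obtain ⟨k'', y'', h''⟩ := Set.mem_iInter.1 hx'' t
    obtain ⟨s, -, rfl, -, -⟩ := hp.desubstitution_prod h h'
    obtain ⟨u, -, rfl, -, -⟩ := hq.desubstitution_prod h h''
    have h1 := h.1.lt_iff_lt.1 hlt
    have h2 : k u ≤ k (s - 1) := h.1.monotone (by omega)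
    have h3 := h.length_eq (s - 1)
    rw [h.apply_cut_sub_one (getLast?_arnouxRauzyProd i t)] at ht
    rw [sub_add_cancel] at h3
    simp only [arnouxRauzyProd] at h3 ht
    omega
  exact le_antisymm (key hx' hx'' hp hq) (key hx'' hx' hq hp)

/-- If configurations in `S` branch at most at one position, then each right ray has at most `r`
left extensions in `S`. -/
theorem encard_left_extensions_le {S : Set (ℤ → Fin r)} (hr : 1 ≤ r)
    (hS : ∀ x ∈ S, ∀ x' ∈ S, ∀ x'' ∈ S, ∀ p q, Branch x p x' p → Branch x q x'' q → p = q)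
    (x : ℤ → Fin r) : {y ∈ S | ∀ k : ℤ, 0 ≤ k → y k = x k}.encard ≤ r := by
  set Y := {y ∈ S | ∀ k : ℤ, 0 ≤ k → y k = x k}
  have hbr : ∀ y ∈ Y, ∀ z ∈ Y, y ≠ z → ∃ p, Branch y p z p := fun y hy z hz hne =>
    exists_branch (fun k hk => (hy.2 k hk).trans (hz.2 k hk).symm) hne
  by_cases hsub : Y.Subsingleton
  · exact (Set.encard_le_one_iff_subsingleton.2 hsub).trans (by exact_mod_cast hr)
  obtain ⟨y, hy, y', hy', hne⟩ := Set.not_subsingleton_iff.1 hsub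
  obtain ⟨p, hp⟩ := hbr y hy y' hy' hne
  have hbase : ∀ z ∈ Y, y ≠ z → Branch y p z p := fun z hz hyz => by
    obtain ⟨q, hq⟩ := hbr y hy z hz hyz
    rwa [hS y hy.1 y' hy'.1 z hz.1 p q hp hq]
  -- Every extension other than `y` splits from `y` at `p`, hence any two extensions split from each
  -- other at `p`.
  have hinj : Set.InjOn (fun z : ℤ → Fin r => z (p - 1)) Y := by
    intro z hz z' hz' hzz'
    by_contra hne'
    by_cases h1 : y = z
    · subst h1
      exact (hbase z' hz' hne').2 hzz'
    · obtain ⟨q, hq⟩ := hbr z hz z' hz' hne'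
      obtain rfl := hS z hz.1 y hy.1 z' hz'.1 p q (hbase z hz h1).symm hq
      exact hq.2 hzz'
  rw [← hinj.encard_image]
  refine (Set.encard_le_encard (Set.subset_univ _)).trans ?_
  simp [Set.encard_univ]

/-- The limit set contains `r` configurations which agree on a right ray and have pairwise distinct
letters just before. -/
theorem exists_left_extensions (i : ℕ → Fin r) :
    ∃ f : Fin r → ℤ → Fin r, (∀ a, f a ∈ limitSet fun t => arnouxRauzySubst (i t)) ∧
      (∀ a, f a (-1) = a) ∧ ∀ a b, ∀ k : ℤ, 0 ≤ k → f a k = f b k := by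
  let K : ℕ → Set (Fin r → ℤ → Fin r) := fun t =>
    (⋂ a, {f | f a ∈ desubstitutable (arnouxRauzyProd i t)}) ∩
      ((⋂ a, {f | f a (-1) = a}) ∩ ⋂ (a) (b) (k : ℤ) (_ : 0 ≤ k), {f | f a k = f b k})
  have hcl : ∀ t, IsClosed (K t) := by
    intro t
    refine (isClosed_iInter fun a => ?_).inter ((isClosed_iInter fun a => ?_).inter
      (isClosed_iInter fun a => isClosed_iInter fun b => isClosed_iInter fun k =>
        isClosed_iInter fun _ => ?_))
    · exact (isClosed_desubstitutable _).preimage (continuous_apply a)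
    · exact isClosed_eq (by fun_prop) continuous_const
    · exact isClosed_eq (by fun_prop) (by fun_prop)
  have hne : ∀ t, (K t).Nonempty := by
    intro t
    -- Only the letter at `-1` depends on `a`; `i 0` is just a common filler. Position 0 is a cut,
    -- and the block before it ends with `a`.
    choose f k h0 hf using fun a : Fin r => exists_isDesubstitution (arnouxRauzyProd_ne_nil i t)
      (fun n => if n = -1 then a else i 0) 0
    refine ⟨f, Set.mem_iInter.2 fun a => ⟨k a, _, hf a⟩, Set.mem_iInter.2 fun a => ?_, ?_⟩
    · have := (hf a).apply_cut_sub_one (getLast?_arnouxRauzyProd i t) 0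
      simpa [h0] using this
    · simp only [Set.mem_iInter]
      intro a b n hn
      refine (hf a).eq_of_ge (hf b) ((h0 a).trans (h0 b).symm) (fun u hu => ?_) ((h0 a).trans_le hn)
      rw [if_neg (by omega), if_neg (by omega)]
  obtain ⟨f, hf⟩ := IsCompact.nonempty_iInter_of_sequence_nonempty_isCompact_isClosed K
    (fun t f hf => ⟨Set.mem_iInter.2 fun a =>
      desubstitutable_succ_subset i t (Set.mem_iInter.1 hf.1 a), hf.2⟩) hne (hcl 0).isCompact hcl
  rw [Set.mem_iInter] at hf
  refine ⟨f, fun a => Set.mem_iInter.2 fun t => Set.mem_iInter.1 (hf t).1 a,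
    fun a => Set.mem_iInter.1 (hf 0).2.1 a, fun a b k hk => ?_⟩
  have := (hf 0).2.2
  simp only [Set.mem_iInter] at this
  exact this a b k hk

theorem arnouxRauzyShift_positivelyExpansive {X : Subshift (Fin r) ℤ} (hr : 2 ≤ r)
    (hX : IsArnouxRauzyShift X) {m : MetricSpace X.carrier} (hm : IsCompatibleMetric X m) :
    ShiftPositivelyExpansive X m r ∧ ¬ ShiftPositivelyExpansive X m (r - 1) := by
  obtain ⟨i, hi, rfl⟩ := hX
  refine ⟨shiftPositivelyExpansive_of_encard_le hm fun x _ =>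
    encard_left_extensions_le (by omega)
      (fun y hy y' hy' y'' hy'' p q => Branch.unique hi hy hy' hy'') x, ?_⟩
  obtain ⟨f, hf, hlast, hray⟩ := exists_left_extensions i
  refine not_shiftPositivelyExpansive_of_injective hm (by omega) f (fun a b hab => ?_) hf hray
  rw [← hlast a, ← hlast b, hab]

end ArnouxRauzy

/-! ### S-adic shifts in the sense of languages -/

theorem exists_eq_of_factor_isInfix {A : Type*} {x x' : ℤ → A} {i j p q : ℤ}
    (h : factor x i j <:+: factor x' p q) :
    ∃ d : ℤ, ∀ m, i ≤ m → m < j → x m = x' (d + m) := by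
  obtain ⟨v, w, h⟩ := h
  refine ⟨p + v.length - i, fun m hi hj => ?_⟩
  have h1 := getElem?_factor x hi hj
  have h2 := congrArg List.length h
  simp only [List.length_append, length_factor] at h2
  have h3 := getElem?_factor x' (i := p) (j := q) (n := p + v.length - i + m) (by omega) (by omega)
  rw [← h, List.getElem?_append_left (by rw [List.length_append, length_factor]; omega),
    List.getElem?_append_right (by omega),
    show (p + v.length - i + m - p).toNat - v.length = (m - i).toNat by omega, h1] at h3
  exact Option.some_injective _ h3

theorem exists_factor_eq {A : Type*} [Nonempty A] (u : List A) :
    ∃ z : ℤ → A, factor z 0 u.length = u := by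
  refine ⟨fun n => u.getD n.toNat (Classical.arbitrary A), ?_⟩
  apply List.ext_getElem
  · simp [length_factor]
  · intro n h1 h2
    simp [factor, h2]

section

variable {r : ℕ}

theorem exists_arnouxRauzyProd_eq_flatMap (i : ℕ → Fin r) {s t : ℕ} (hst : s ≤ t) (a : Fin r) :
    ∃ u : List (Fin r), arnouxRauzyProd i t a = u.flatMap (arnouxRauzyProd i s) := by
  induction t, hst using Nat.le_induction generalizing a with
  | base => exact ⟨[a], by simp⟩
  | succ t _ ih =>
    choose u hu using ih
    refine ⟨(arnouxRauzySubst (i t) a).flatMap u, ?_⟩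
    rw [List.flatMap_assoc]
    exact congrArg (fun g => List.flatMap g (arnouxRauzySubst (i t) a)) (funext hu)

/-- Each window of `x` occurs in a configuration desubstitutable at level `s`, and the set of these
is closed and shift-invariant. -/
theorem sadicSet_subset_limitSet (i : ℕ → Fin r) :
    sadicSet (fun t => arnouxRauzySubst (i t)) ⊆ limitSet fun t => arnouxRauzySubst (i t) := by
  intro x hx
  refine Set.mem_iInter.2 fun s => ?_
  have key : ∀ n : ℕ, ∃ x' ∈ desubstitutable (arnouxRauzyProd i s),
      ∀ m : ℤ, -n ≤ m → m < n → x m = x' m := by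
    intro n
    obtain ⟨t, a, h⟩ := hx (-n) n
    -- The level `t` may lie below `s`; the suffix property moves the window up to level `max t s`.
    obtain ⟨u, hu⟩ := exists_arnouxRauzyProd_eq_flatMap i (le_max_right t s) a
    have h' := h.trans (arnouxRauzyProd_suffix i (le_max_left t s) a).isInfix
    have : Nonempty (Fin r) := ⟨a⟩
    obtain ⟨z, hz⟩ := exists_factor_eq u
    obtain ⟨x', k, h0, hk⟩ := exists_isDesubstitution (arnouxRauzyProd_ne_nil i s) z 0
    rw [hu, ← hz, ← hk.factor_eq_flatMap (by omega)] at h'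
    obtain ⟨d, hd⟩ := exists_eq_of_factor_isInfix h'
    exact ⟨shift d x', mapsTo_desubstitutable _ d ⟨k, z, hk⟩, hd⟩
  choose x' hx' heq using key
  refine (isClosed_desubstitutable _).mem_of_tendsto (f := x') (b := Filter.atTop) ?_
    (Filter.Eventually.of_forall hx')
  refine tendsto_pi_nhds.2 fun m => tendsto_nhds_of_eventually_eq ?_
  filter_upwards [Filter.eventually_ge_atTop (m.natAbs + 1)] with n hn
  exact (heq n m (by omega) (by omega)).symm

theorem isAperiodicDirective_of_frequently (hr : 2 ≤ r) {i : ℕ → Fin r}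
    (hi : ∀ a : Fin r, ∃ᶠ t in Filter.atTop, i t = a) : IsAperiodicDirective i := by
  rintro ⟨a, ha⟩
  have : Nontrivial (Fin r) := Fin.nontrivial_iff_two_le.2 hr
  obtain ⟨b, hb⟩ := exists_ne a
  obtain ⟨t, h1, h2⟩ := ((hi b).and_eventually ha).exists
  exact hb (h1.symm.trans h2)

/-- If each letter occurs infinitely often in the directive sequence, then the configurations of the
limit set which branch at `0` belong to the S-adic shift in the sense of languages. -/
theorem Branch.mem_sadicSet {i : ℕ → Fin r} (hr : 2 ≤ r)
    (hi : ∀ a : Fin r, ∃ᶠ t in Filter.atTop, i t = a) {x x' : ℤ → Fin r}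
    (hx : x ∈ limitSet fun t => arnouxRauzySubst (i t))
    (hx' : x' ∈ limitSet fun t => arnouxRauzySubst (i t)) (hb : Branch x 0 x' 0) :
    x ∈ sadicSet fun t => arnouxRauzySubst (i t) := by
  intro u v
  rcases lt_or_ge v u with huv | huv
  · refine ⟨0, i 0, ?_⟩
    have : factor x u v = [] := by
      rw [← List.length_eq_zero_iff, length_factor]
      omega
    rw [this]
    exact List.nil_infix
  have : Nontrivial (Fin r) := Fin.nontrivial_iff_two_le.2 hr
  obtain ⟨b, hb'⟩ := exists_ne (x (-1))
  have hlen : ∀ᶠ t in Filter.atTop, ∀ a, u.natAbs + v.natAbs ≤ (arnouxRauzyProd i t a).length :=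
    Filter.eventually_all.2 fun a => (tendsto_length_arnouxRauzyProd
      (isAperiodicDirective_of_frequently hr hi) a).eventually_ge_atTop _
  obtain ⟨t, hlt, ht⟩ := ((hi b).and_eventually hlen).exists
  obtain ⟨k, z, h⟩ := Set.mem_iInter.1 hx (t + 1)
  obtain ⟨k', z', h'⟩ := Set.mem_iInter.1 hx' (t + 1)
  obtain ⟨l, w, m, h1, h2, -⟩ := h.split_arnouxRauzyProd
  obtain ⟨l', w', m', h1', h2', -⟩ := h'.split_arnouxRauzyProd
  obtain ⟨s, s', hs, -, hbw⟩ := hb.desubstitution_prod h1 h1'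
  -- Lifting the branching through one more substitution `τ_{i_t}` reveals the level-`t` letter that
  -- follows it.
  have hws : w s = i t := (hbw.desubstitution h2 h2').1
  have hws' : x (-1) = w (s - 1) := by
    simpa [hs] using h1.apply_cut_sub_one (getLast?_arnouxRauzyProd i t) s
  have e1 := h1.length_eq (s - 1)
  have e2 := h1.length_eq s
  have ht1 := ht (w (s - 1))
  have ht2 := ht (w s)
  rw [sub_add_cancel] at e1
  have hinf : factor x u v <:+: arnouxRauzyProd i t (x (-1)) ++ arnouxRauzyProd i t (i t) := by
    refine (factor_isInfix x (k := l (s - 1)) (l := l (s + 1)) huv (by omega) (by omega)).trans ?_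
    rw [h1.factor_eq_flatMap (by omega), ← factor_append w (j := s) (by omega) (by omega),
      factor_add_one]
    have := factor_add_one w (s - 1)
    rw [sub_add_cancel] at this
    rw [this, hws, hws']
    simp
  -- As `i t' = x (-1) ≠ b`, the image of `b` at level `t' + 1` is the level-`t'` image of `x (-1)`
  -- followed by that of `b`. The former ends with the level-`t` image of `x (-1)`, the latter
  -- begins with that of `i t`.
  obtain ⟨t', htt', ht'⟩ := Filter.frequently_atTop.1 (hi (x (-1))) (t + 1)
  refine ⟨t' + 1, b, hinf.trans ?_⟩
  change _ <:+: arnouxRauzyProd i (t' + 1) b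
  rw [arnouxRauzyProd_succ, ht', if_neg hb']
  obtain ⟨α, hα⟩ := arnouxRauzyProd_suffix i (by omega : t ≤ t') (x (-1))
  obtain ⟨β, hβ⟩ := arnouxRauzyProd_prefix i (by omega : t < t') b
  exact ⟨α, β, by rw [← hα, ← hβ]; simp⟩

theorem sadicShift_positivelyExpansive (hr : 2 ≤ r) {i : ℕ → Fin r}
    (hi : ∀ a : Fin r, ∃ᶠ t in Filter.atTop, i t = a)
    {m : MetricSpace (sadicShift fun t => arnouxRauzySubst (i t)).carrier}
    (hm : IsCompatibleMetric _ m) :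
    ShiftPositivelyExpansive _ m r ∧ ¬ ShiftPositivelyExpansive _ m (r - 1) := by
  have hsub := sadicSet_subset_limitSet i
  refine ⟨shiftPositivelyExpansive_of_encard_le hm fun x _ =>
    encard_left_extensions_le (by omega) (fun y hy y' hy' y'' hy'' p q =>
      Branch.unique (isAperiodicDirective_of_frequently hr hi) (hsub hy) (hsub hy') (hsub hy'')) x,
    ?_⟩
  obtain ⟨f, hf, hlast, hray⟩ := exists_left_extensions i
  have : Nontrivial (Fin r) := Fin.nontrivial_iff_two_le.2 hr
  refine not_shiftPositivelyExpansive_of_injective hm (by omega) f (fun a b hab => ?_)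
    (fun a => ?_) hray
  · rw [← hlast a, ← hlast b, hab]
  · obtain ⟨b, hb⟩ := exists_ne a
    refine Branch.mem_sadicSet hr hi (hf a) (hf b) ⟨fun n => hray a b _ (by omega), ?_⟩
    simpa [hlast] using hb.symm

end

/-! ### Sturmian shifts -/

/-- A surjection between finite sets whose cardinalities differ by at most one has at most one
nontrivial fiber. -/
theorem Set.map_eq_of_ncard_le_add_one {α β : Type*} {S : Set α} {T : Set β} {f : α → β}
    (hfin : S.Finite) (hsurj : T ⊆ f '' S) (hcard : S.ncard ≤ T.ncard + 1) {a a' b b' : α}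
    (ha : a ∈ S) (ha' : a' ∈ S) (hb : b ∈ S) (hb' : b' ∈ S) (hne : a ≠ a') (haa' : f a = f a')
    (hne' : b ≠ b') (hbb' : f b = f b') : f a = f b := by
  by_contra hab
  -- Two distinct nontrivial fibers would allow both `a'` and `b'` to be dropped and `T` still be
  -- covered.
  have hsub : T ⊆ f '' (S \ {a', b'}) := by
    intro y hy
    obtain ⟨c, hc, rfl⟩ := hsurj hy
    by_cases h1 : c = a'
    · refine ⟨a, ⟨ha, ?_⟩, h1 ▸ haa'⟩
      rintro (h2 | h2)
      · exact hne h2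
      · exact hab (by rw [h2, hbb'])
    by_cases h2 : c = b'
    · refine ⟨b, ⟨hb, ?_⟩, h2 ▸ hbb'⟩
      rintro (h3 | h3)
      · exact hab (by rw [haa', h3])
      · exact hne' h3
    · exact ⟨c, ⟨hc, by simp [h1, h2]⟩, rfl⟩
  have hne'' : a' ≠ b' := fun h => hab (by rw [haa', hbb', h])
  have h1 := (Set.ncard_le_ncard hsub (hfin.sdiff.image f)).trans (Set.ncard_image_le hfin.sdiff)
  have h2 : ({a', b'} : Set α) ⊆ S := by
    rintro c (rfl | rfl) <;> assumption
  have h3 := Set.ncard_sdiff_add_ncard_of_subset h2 hfin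
  rw [Set.ncard_pair hne''] at h3
  omega

theorem factor_succ_eq_cons {A : Type*} (x : ℤ → A) (n : ℕ) :
    factor x 0 (n + 1 : ℕ) = x 0 :: factor (shift 1 x) 0 n := by
  rw [factor_shift, ← factor_append x (j := 1) (by omega) (by omega)]
  have h : factor x 0 1 = [x 0] := by simpa using factor_add_one x 0
  rw [h, add_zero, add_comm (1 : ℤ)]
  simp

section Complexity

variable {A : Type*} [TopologicalSpace A]

/-- The words of length `n` of the `ℤ`-shift `X`. -/
def words (X : Subshift A ℤ) (n : ℕ) : Set (List A) :=
  (fun x => factor x 0 n) '' X.carrier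

/-- Points are two-sided, so the window can be moved one step back. -/
theorem words_subset_image_tail (X : Subshift A ℤ) (n : ℕ) :
    words X n ⊆ List.tail '' words X (n + 1) := by
  rintro _ ⟨x, hx, rfl⟩
  refine ⟨_, ⟨shift (-1) x, X.mapsTo _ hx, rfl⟩, ?_⟩
  simp only [factor_succ_eq_cons, List.tail_cons]
  congr 1
  funext k
  simp [shift_apply]

/-- In a `ℤ`-shift with `n + 1` words of length `n`, all branchings have the same right ray. -/
theorem Branch.eq_of_ncard_words {X : Subshift A ℤ} (hX : ∀ n, (words X n).ncard = n + 1)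
    {x x' y y' : ℤ → A} (hx : x ∈ X.carrier) (hx' : x' ∈ X.carrier) (hy : y ∈ X.carrier)
    (hy' : y' ∈ X.carrier) {p q : ℤ} (h : Branch x p x' p) (h' : Branch y q y' q) (n : ℕ) :
    x (p + n) = y (q + n) := by
  have hfin : (words X (n + 2)).Finite := Set.finite_of_ncard_pos (by rw [hX]; omega)
  have mem : ∀ z ∈ X.carrier, ∀ s, factor (shift s z) 0 (n + 2 : ℕ) ∈ words X (n + 2) :=
    fun z hz s => ⟨_, X.mapsTo s hz, rfl⟩
  -- Words of length `n + 2` read from `s - 1` leave a tail of `n + 1` letters, which reaches the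
  -- position `s + n`.
  have key : ∀ {z z' : ℤ → A} {s : ℤ}, Branch z s z' s →
      factor (shift (s - 1) z) 0 (n + 2 : ℕ) ≠ factor (shift (s - 1) z') 0 (n + 2 : ℕ) ∧
      (factor (shift (s - 1) z) 0 (n + 2 : ℕ)).tail =
        (factor (shift (s - 1) z') 0 (n + 2 : ℕ)).tail := by
    intro z z' s hb
    constructor
    · intro he
      have := eq_of_factor_eq he (n := 0) (by push_cast; omega)
      simp only [shift_apply] at this
      exact hb.2 (by simpa using this)
    · simp only [factor_succ_eq_cons _ (n + 1), List.tail_cons]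
      refine factor_congr rfl fun j _ => ?_
      simp only [shift_apply]
      convert hb.1 j using 2 <;> ring
  have h1 := Set.map_eq_of_ncard_le_add_one (f := List.tail) hfin
    (words_subset_image_tail X (n + 1)) (by rw [hX, hX])
    (mem x hx (p - 1)) (mem x' hx' (p - 1)) (mem y hy (q - 1)) (mem y' hy' (q - 1))
    (key h).1 (key h).2 (key h').1 (key h').2
  simp only [factor_succ_eq_cons _ (n + 1), List.tail_cons] at h1
  have h2 := eq_of_factor_eq h1 (n := n) (by push_cast; omega)
  simp only [shift_apply] at h2
  convert h2 using 2 <;> ring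

/-- A minimal `ℤ`-shift with `n + 1` words of length `n` has no eventually periodic point. -/
theorem not_eventually_periodic_of_ncard_words {X : Subshift A ℤ} [DiscreteTopology A]
    (hmin : ∀ Y : Subshift A ℤ, Y.carrier ⊆ X.carrier → Y.carrier.Nonempty →
      Y.carrier = X.carrier) (hX : ∀ n, (words X n).ncard = n + 1)
    {x : ℤ → A} (hx : x ∈ X.carrier) (q : ℤ) {d : ℕ} (hd : 0 < d) :
    ¬ ∀ n : ℕ, x (q + n + d) = x (q + n) := by
  intro hper
  have hmul : ∀ j m : ℕ, x (q + j + m * d) = x (q + j) := by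
    intro j m
    induction m with
    | zero => simp
    | succ m ih =>
      rw [← ih]
      have := hper (j + m * d)
      push_cast at this ⊢
      convert this using 2 <;> ring
  have hmod : ∀ n : ℤ, 0 ≤ n → x (q + n) = x (q + n % d) := by
    intro n hn
    have h1 := hmul (n % d).toNat (n / d).toNat
    rw [Int.toNat_of_nonneg (Int.emod_nonneg _ (by omega)),
      Int.toNat_of_nonneg (Int.ediv_nonneg hn (by omega))] at h1
    rw [← h1, add_assoc, mul_comm, Int.emod_add_mul_ediv]
  -- The `d`-periodic points of `X` form a subshift. Once it is nonempty, minimality makes it all of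
  -- `X`; then the first `d` letters of a word of length `d + 1` determine the last, which
  -- contradicts the count.
  let Y : Subshift A ℤ :=
    { carrier := X.carrier ∩ ⋂ k : ℤ, {z | z (k + d) = z k}
      isClosed := X.isClosed.inter (isClosed_iInter fun k =>
        isClosed_eq (continuous_apply _) (continuous_apply _))
      mapsTo := fun g z hz => ⟨X.mapsTo g hz.1, Set.mem_iInter.2 fun k => by
        have := Set.mem_iInter.1 hz.2 (g + k)
        simpa [shift_apply, add_assoc] using this⟩ }
  have hz : (fun k : ℤ => x (q + k % d)) ∈ Y.carrier := by
    refine ⟨?_, Set.mem_iInter.2 fun k => by simp⟩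
    -- Shifts by `m * d + q` keep the phase fixed while the periodic ray fills every window.
    refine X.isClosed.mem_of_tendsto (f := fun m : ℕ => shift (m * d + q : ℤ) x)
      (b := Filter.atTop) (tendsto_pi_nhds.2 fun k => tendsto_nhds_of_eventually_eq ?_)
      (Filter.Eventually.of_forall fun m => X.mapsTo _ hx)
    filter_upwards [Filter.eventually_ge_atTop k.natAbs] with m hm
    have h1 : (m : ℤ) ≤ m * d := le_mul_of_one_le_right (by omega) (by omega)
    have h2 := hmod (m * d + k) (by omega)
    rw [add_comm ((m : ℤ) * d) k, Int.add_mul_emod_self_right] at h2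
    rw [shift_apply, ← h2]
    congr 1
    ring
  have hYX := hmin Y Set.inter_subset_left ⟨_, hz⟩
  have hperX : ∀ y ∈ X.carrier, ∀ k : ℤ, y (k + d) = y k := fun y hy k => by
    rw [← hYX] at hy
    exact Set.mem_iInter.1 hy.2 k
  have htake : ∀ y : ℤ → A, (factor y 0 (d + 1 : ℕ)).take d = factor y 0 d := fun y => by
    rw [← factor_append y (j := d) (by omega) (by push_cast; omega)]
    exact List.take_left' (by rw [length_factor]; omega)
  have hle : (words X (d + 1)).ncard ≤ (words X d).ncard := by
    refine Set.ncard_le_ncard_of_injOn (List.take d) ?_ ?_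
      (Set.finite_of_ncard_pos (by rw [hX]; omega))
    · rintro _ ⟨y, hy, rfl⟩
      exact ⟨y, hy, (htake y).symm⟩
    · rintro _ ⟨y, hy, rfl⟩ _ ⟨y', hy', rfl⟩ he
      simp only [htake] at he
      refine factor_congr rfl fun n hn => ?_
      rcases lt_or_ge n d with h1 | h1
      · exact eq_of_factor_eq he (by omega)
      · have h2 : n = d := by push_cast at hn; omega
        subst h2
        rw [hperX y hy, hperX y' hy']
        simpa using eq_of_factor_eq he (n := 0) (by omega)
  rw [hX, hX] at hle
  omega

/-- A `ℤ`-shift with `n + 1` words of length `n` has a branching. -/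
theorem exists_branch_of_ncard_words {X : Subshift A ℤ} [DiscreteTopology A] [Finite A]
    (hX : ∀ n, (words X n).ncard = n + 1) :
    ∃ x ∈ X.carrier, ∃ x' ∈ X.carrier, Branch x 0 x' 0 := by
  let K : ℕ → Set ((ℤ → A) × (ℤ → A)) := fun n =>
    (X.carrier ×ˢ X.carrier) ∩ ({p | p.1 (-1) = p.2 (-1)}ᶜ ∩
      ⋂ (k : ℕ) (_ : k < n), {p | p.1 k = p.2 k})
  have hcl : ∀ n, IsClosed (K n) := by
    intro n
    refine (X.isClosed.prod X.isClosed).inter (IsClosed.inter ?_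
      (isClosed_iInter fun k => isClosed_iInter fun _ => isClosed_eq (by fun_prop) (by fun_prop)))
    exact (isClosed_discrete {q : A × A | q.1 = q.2}ᶜ).preimage
      (f := fun p : (ℤ → A) × (ℤ → A) => (p.1 (-1), p.2 (-1))) (by fun_prop)
  have hne : ∀ n, (K n).Nonempty := by
    intro n
    -- Pigeonhole: `n + 2` words share `n + 1` tails. The shift by 1 then puts the differing first
    -- letters at `-1`.
    obtain ⟨_, ⟨y, hy, rfl⟩, _, ⟨y', hy', rfl⟩, hne, heq⟩ :=
      Set.exists_ne_map_eq_of_ncard_lt_of_maps_to (s := words X (n + 1)) (t := words X n)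
        (f := List.tail) (by rw [hX, hX]; omega)
        (by
          rintro _ ⟨y, hy, rfl⟩
          exact ⟨shift 1 y, X.mapsTo 1 hy, by simp only [factor_succ_eq_cons, List.tail_cons]⟩)
        (Set.finite_of_ncard_pos (by rw [hX]; omega))
    simp only [factor_succ_eq_cons, List.tail_cons] at hne heq
    refine ⟨(shift 1 y, shift 1 y'), ⟨X.mapsTo 1 hy, X.mapsTo 1 hy'⟩, fun h0 => ?_, ?_⟩
    · have h1 : y 0 = y' 0 := by simpa [shift_apply] using h0
      exact hne (by rw [h1, heq])
    · simp only [Set.mem_iInter]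
      intro k hk
      simpa using eq_of_factor_eq heq (n := k) (by omega)
  obtain ⟨p, hp⟩ := IsCompact.nonempty_iInter_of_sequence_nonempty_isCompact_isClosed K
    (fun n p hp => ⟨hp.1, hp.2.1, Set.mem_iInter₂.2 fun k hk =>
      Set.mem_iInter₂.1 hp.2.2 k (hk.trans (Nat.lt_succ_self n))⟩) hne (hcl 0).isCompact hcl
  rw [Set.mem_iInter] at hp
  refine ⟨p.1, (hp 0).1.1, p.2, (hp 0).1.2, fun n => ?_, (hp 0).2.1⟩
  simpa using Set.mem_iInter₂.1 (hp (n + 1)).2.2 n (Nat.lt_succ_self n)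

end Complexity

theorem sturmianShift_positivelyExpansive {X : Subshift (Fin 2) ℤ} (hX : IsSturmianShift X)
    {m : MetricSpace X.carrier} (hm : IsCompatibleMetric X m) :
    ShiftPositivelyExpansive X m 2 ∧ ¬ ShiftPositivelyExpansive X m 1 := by
  obtain ⟨-, hmin, hcard⟩ := hX
  have hwords : ∀ n, (words X n).ncard = n + 1 := hcard
  constructor
  · refine shiftPositivelyExpansive_of_encard_le hm fun x _ =>
      encard_left_extensions_le one_le_two ?_ x
    have key : ∀ y ∈ X.carrier, ∀ y' ∈ X.carrier, ∀ y'' ∈ X.carrier, ∀ p q,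
        Branch y p y' p → Branch y q y'' q → p ≤ q := by
      intro y hy y' hy' y'' hy'' p q hp hq
      by_contra! hlt
      -- The rays of `y` from `p` and from `q` coincide, so `y` has period `p - q` from `q` on.
      refine not_eventually_periodic_of_ncard_words hmin hwords hy q (d := (p - q).toNat)
        (by omega) fun n => ?_
      rw [← hp.eq_of_ncard_words hwords hy hy' hy hy'' hq n]
      congr 1
      omega
    exact fun y hy y' hy' y'' hy'' p q hp hq =>
      le_antisymm (key y hy y' hy' y'' hy'' p q hp hq) (key y hy y'' hy'' y' hy' q p hq hp)
  · obtain ⟨x, hx, x', hx', hb⟩ := exists_branch_of_ncard_words hwords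
    refine not_shiftPositivelyExpansive_of_injective hm one_lt_two ![x, x'] ?_ ?_ ?_
    · have hne : x ≠ x' := fun h => hb.2 (congrFun h _)
      intro a b
      fin_cases a <;> fin_cases b <;> simp [hne, hne.symm]
    · intro a
      fin_cases a <;> assumption
    · intro a b k hk
      have h := hb.1 k.toNat
      rw [zero_add, Int.toNat_of_nonneg hk] at h
      fin_cases a <;> fin_cases b <;> simp [h]

theorem corollaryc :
    (∀ r : ℕ, 2 ≤ r →
      (∀ X : Subshift (Fin r) ℤ, IsArnouxRauzyShift X →
        ∀ m : MetricSpace X.carrier, IsCompatibleMetric X m →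
          ShiftPositivelyExpansive X m r ∧ ¬ ShiftPositivelyExpansive X m (r - 1)) ∧
      (∀ i : ℕ → Fin r, (∀ a : Fin r, ∃ᶠ t in Filter.atTop, i t = a) →
        ∀ m : MetricSpace (sadicShift fun t => arnouxRauzySubst (i t)).carrier,
          IsCompatibleMetric _ m →
          ShiftPositivelyExpansive _ m r ∧ ¬ ShiftPositivelyExpansive _ m (r - 1))) ∧
    (∀ X : Subshift (Fin 2) ℤ, IsSturmianShift X →
      ∀ m : MetricSpace X.carrier, IsCompatibleMetric X m →
        ShiftPositivelyExpansive X m 2 ∧ ¬ ShiftPositivelyExpansive X m 1) := by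
  refine ⟨fun r hr => ⟨fun X hX m hm => ?_, fun i hi m hm => ?_⟩, fun X hX m hm => ?_⟩
  · exact arnouxRauzyShift_positivelyExpansive hr hX hm
  · exact sadicShift_positivelyExpansive hr hi hm
  · exact sturmianShift_positivelyExpansive hX hm
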